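/- Let $s>2$ be an integer and $A=\{0,1,\dots,s-1\}$. For a sequence $(d_k)_{k\ge1}$ in $A$ write $\Delta^s_{d_1d_2\dots}=\sum_{k\ge1}d_ks^{-k}$. For $u\in A$ let $$\mathbb S_{(s,u)}=\Bigl\{\Delta^s_{\underbrace{u\dots u}_{\alpha_1-1}\alpha_1\underbrace{u\dots u}_{\alpha_2-1}\alpha_2\dots\underbrace{u\dots u}_{\alpha_n-1}\alpha_n\dots}\;:\;\alpha_n\in A\setminus\{0,u\}\text{ for all }n\ge1\Bigr\},\qquad \mathbb S_0=\bigcup_{u=0}^{s-1}\mathbb S_{(s,u)}.$$ Call $x\in[0,1]$ a normal number in base $s$ if it has a base-$s$ expansion $x=\Delta^s_{d_1d_2\dots}$ in which every digit $i\in A$ has frequency $1/s$, that is, $\lim_{k\to\infty}\frac1k\#\{j\le k: d_j=i\}=\frac1s$. (A number with two base-$s$ expansions is not normal with respect to either of them.) Then: - if $s=3$, the set of normal numbers in base $3$ that belong to $\mathbb S_0$ has the cardinality of the continuum, is a subset of $\mathbb S_{(3,0)}$, and its Hausdorff dimension $\alpha_0$ satisfies $$\tfrac13\log_3 2\;\le\;\alpha_0\;\le\;\log_3\frac{2}{\sqrt5-1};$$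 - if $s\neq3$ (that is, $s>3$), the set of normal numbers in base $s$ that belong to $\mathbb S_0$ is empty. -/

import Mathlib

open Filter Topology

noncomputable section

namespace SAdic

/-- The digit sequence `d` (indexed from `0`) is the concatenation of the blocks
`u … u αₙ` (`αₙ - 1` copies of `u`, then `αₙ`), `n = 0, 1, 2, …`.
The block of `αₙ` has length `αₙ`, so `αₙ` itself stands at the place (counted from `1`) with
number `α₀ + … + αₙ`; every other place holds `u`. -/
def IsBlockConcat {s : ℕ} (u : Fin s) (α : ℕ → Fin s) (d : ℕ → Fin s) : Prop :=
  (∀ n k : ℕ, k + 1 = ∑ i ∈ Finset.range (n + 1), (α i : ℕ) → d k = α n) ∧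
  (∀ k : ℕ, (∀ n : ℕ, k + 1 ≠ ∑ i ∈ Finset.range (n + 1), (α i : ℕ)) → d k = u)

/-- The set of the numbers whose base-`s` expansion is a concatenation of blocks `u … u αₙ`
as above, for some sequence of digits `αₙ` different from `0` and from `u`. -/
def S (s : ℕ) (u : Fin s) : Set ℝ :=
  {x | ∃ α d : ℕ → Fin s, (∀ n, (α n : ℕ) ≠ 0 ∧ α n ≠ u) ∧ IsBlockConcat u α d ∧
    x = Real.ofDigits d}

/-- The union of the sets `S s u` over all digits `u`. -/
def S₀ (s : ℕ) : Set ℝ := ⋃ u : Fin s, S s u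

/-- The number of occurrences of the digit `i` among the first `k` digits of `d`. -/
def digitCount {s : ℕ} (d : ℕ → Fin s) (i : Fin s) (k : ℕ) : ℕ :=
  ((Finset.range k).filter (fun j => d j = i)).card

/-- The digit `i` has frequency `v` in the digit sequence `d`. -/
def HasFrequency {s : ℕ} (d : ℕ → Fin s) (i : Fin s) (v : ℝ) : Prop :=
  Tendsto (fun k : ℕ => (digitCount d i k : ℝ) / (k : ℝ)) atTop (𝓝 v)

/-- The normal numbers in base `s`: the numbers of `[0, 1]` in whose base-`s` expansion every
digit has frequency `1 / s`. (A number with two expansions has in both of them a digit of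
frequency `1`, so for `s ≥ 2` the choice of the expansion is immaterial.) -/
def normalNumbers (s : ℕ) : Set ℝ :=
  {x | x ∈ Set.Icc (0 : ℝ) 1 ∧
    ∃ d : ℕ → Fin s, x = Real.ofDigits d ∧ ∀ i : Fin s, HasFrequency d i ((s : ℝ)⁻¹)}

end SAdic

end

namespace SAdic

/-! ### Base-`b` expansions -/

/-! An expansion in which all digits are equally frequent is the only one of its number, so it is
the block expansion. If `u ≠ 0`, the digit 0 never occurs in it; hence `u = 0`
(`exists_isBlockConcat_of_mem`). A block `0 … 0 a` has length `a` and digit sum `a`, so the mean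
digit up to a block end is 1, while normality makes it tend to `(s - 1) / 2`; thus `s = 3`.

For `s = 3` the upper bound holds for all of `S 3 0`: a block of length 1 or 2 contracts by `1/3` or
`1/9`, and the dimension is at most the root `t` of `3⁻ᵗ + 9⁻ᵗ = 1`. For the lower bound and the
cardinality, the words 021 and 102 are concatenated freely. Each contains every digit once and
splits into blocks (02|1 and 1|02). Reading the choices of words as binary digits maps these numbers
onto `[0, 1]`, Hölder with exponent `log₂₇ 2`. -/

lemma ofDigits_eq_head_add_tail {b : ℕ} (d : ℕ → Fin b) :
    (b : ℝ) * Real.ofDigits d = (d 0 : ℕ) + Real.ofDigits (fun i => d (i + 1)) := by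
  have hb : (b : ℝ) ≠ 0 := by exact_mod_cast (Fin.pos (d 0)).ne'
  rw [Real.ofDigits_eq_sum_add_ofDigits d 1]
  simp only [Finset.sum_range_one, Real.ofDigitsTerm, zero_add, pow_one]
  field_simp

lemma val_eq_zero_of_ofDigits_eq_zero {b : ℕ} (k : ℕ) :
    ∀ d : ℕ → Fin b, Real.ofDigits d = 0 → (d k : ℕ) = 0 := by
  have step : ∀ d : ℕ → Fin b, Real.ofDigits d = 0 →
      (d 0 : ℕ) = 0 ∧ Real.ofDigits (fun i => d (i + 1)) = 0 := by
    intro d hd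
    have h := ofDigits_eq_head_add_tail d
    rw [hd, mul_zero] at h
    have h1 := Real.ofDigits_nonneg (fun i => d (i + 1))
    have h2 : (0 : ℝ) ≤ (d 0 : ℕ) := Nat.cast_nonneg _
    refine ⟨?_, by linarith⟩
    have : ((d 0 : ℕ) : ℝ) = 0 := by linarith
    exact_mod_cast this
  induction k with
  | zero => exact fun d hd => (step d hd).1
  | succ k ih => exact fun d hd => ih (fun i => d (i + 1)) (step d hd).2

lemma val_add_one_eq_of_ofDigits_eq_one {b : ℕ} (k : ℕ) :
    ∀ d : ℕ → Fin b, Real.ofDigits d = 1 → (d k : ℕ) + 1 = b := by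
  have step : ∀ d : ℕ → Fin b, Real.ofDigits d = 1 →
      (d 0 : ℕ) + 1 = b ∧ Real.ofDigits (fun i => d (i + 1)) = 1 := by
    intro d hd
    have h := ofDigits_eq_head_add_tail d
    rw [hd, mul_one] at h
    have h1 := Real.ofDigits_le_one (fun i => d (i + 1))
    have h2 : (((d 0 : ℕ) + 1 : ℕ) : ℝ) ≤ b := by exact_mod_cast (d 0).isLt
    push_cast at h2
    refine ⟨?_, by linarith⟩
    have : ((d 0 : ℕ) : ℝ) + 1 = b := by linarith
    exact_mod_cast this
  induction k with
  | zero => exact fun d hd => (step d hd).1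
  | succ k ih => exact fun d hd => ih (fun i => d (i + 1)) (step d hd).2

/-- If two digit sequences agree in the first `n` places, their values differ by `b⁻ⁿ` times the
difference of the values of the tails. -/
lemma ofDigits_sub_ofDigits {b : ℕ} {d e : ℕ → Fin b} {n : ℕ} (h : ∀ i < n, d i = e i) :
    Real.ofDigits d - Real.ofDigits e =
      ((b : ℝ) ^ n)⁻¹ *
        (Real.ofDigits (fun i => d (i + n)) - Real.ofDigits (fun i => e (i + n))) := by
  rw [Real.ofDigits_eq_sum_add_ofDigits d n, Real.ofDigits_eq_sum_add_ofDigits e n,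
    Finset.sum_congr rfl fun i hi => by
      rw [Real.ofDigitsTerm, h i (Finset.mem_range.mp hi), ← Real.ofDigitsTerm]]
  ring

lemma exists_first_difference {β : Type*} {d e : ℕ → β} (h : d ≠ e) :
    ∃ n, d n ≠ e n ∧ ∀ i < n, d i = e i := by
  classical
  have h' : ∃ n, d n ≠ e n := Function.ne_iff.mp h
  exact ⟨Nat.find h', Nat.find_spec h', fun i hi => not_not.mp (Nat.find_min h' hi)⟩

/-- The heads at place `n` differ by at least 1 and the tails lie in `[0, 1]`, so equal values force
both tails to be extreme. -/
lemma tail_eq_of_ofDigits_eq_of_lt {b : ℕ} {d e : ℕ → Fin b} {n : ℕ}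
    (hv : Real.ofDigits d = Real.ofDigits e) (h : ∀ i < n, d i = e i) (hlt : d n < e n) :
    Real.ofDigits (fun i => d (i + (n + 1))) = 1 ∧
      Real.ofDigits (fun i => e (i + (n + 1))) = 0 := by
  have hb : (b : ℝ) ≠ 0 := by exact_mod_cast (Fin.pos (d 0)).ne'
  have h0 := ofDigits_sub_ofDigits h
  rw [hv, sub_self, eq_comm, mul_eq_zero] at h0
  have h1 := h0.resolve_left (by positivity)
  have hd := ofDigits_eq_head_add_tail fun i => d (i + n)
  have he := ofDigits_eq_head_add_tail fun i => e (i + n)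
  simp only [zero_add, add_assoc, add_comm 1 n] at hd he
  have hle : (((d n : ℕ) + 1 : ℕ) : ℝ) ≤ (e n : ℕ) := by exact_mod_cast hlt
  push_cast at hle
  rw [sub_eq_zero.mp h1] at hd
  have h2 := Real.ofDigits_le_one (fun i => d (i + (n + 1)))
  have h3 := Real.ofDigits_nonneg (fun i => e (i + (n + 1)))
  constructor <;> linarith

/-- A number with two expansions has only eventually constant ones. -/
lemma exists_eventually_const_of_ofDigits_eq {b : ℕ} {d e : ℕ → Fin b} (hne : d ≠ e)
    (hv : Real.ofDigits d = Real.ofDigits e) : ∃ c N, ∀ k ≥ N, d k = c := by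
  obtain ⟨n, hn, h⟩ := exists_first_difference hne
  refine ⟨d (n + 1), n + 1, fun k hk => Fin.ext ?_⟩
  obtain ⟨j, rfl⟩ := Nat.exists_eq_add_of_le' hk
  rcases lt_or_gt_of_ne hn with hlt | hlt
  · have ht := (tail_eq_of_ofDigits_eq_of_lt hv h hlt).1
    have h1 := val_add_one_eq_of_ofDigits_eq_one j _ ht
    have h2 := val_add_one_eq_of_ofDigits_eq_one 0 _ ht
    simp only [zero_add] at h2
    omega
  · have ht := (tail_eq_of_ofDigits_eq_of_lt hv.symm (fun i hi => (h i hi).symm) hlt).2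
    have h1 := val_eq_zero_of_ofDigits_eq_zero j _ ht
    have h2 := val_eq_zero_of_ofDigits_eq_zero 0 _ ht
    simp only [zero_add] at h2
    omega

/-! ### Frequencies -/

lemma hasFrequency_zero_of_eventually_ne {s : ℕ} {d : ℕ → Fin s} {i : Fin s} {N : ℕ}
    (h : ∀ k ≥ N, d k ≠ i) : HasFrequency d i 0 := by
  have hle : ∀ k, digitCount d i k ≤ N := by
    intro k
    calc digitCount d i k ≤ (Finset.range N).card := Finset.card_le_card fun j hj => by
          simp only [Finset.mem_filter] at hj
          by_contra hjN
          exact h j (by simpa using hjN) hj.2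
      _ = N := Finset.card_range N
  refine squeeze_zero (fun k => by positivity) (fun k => ?_)
    (tendsto_const_div_atTop_nhds_zero_nat (N : ℝ))
  gcongr
  exact hle k

lemma not_hasFrequency_inv_of_eventually_ne {s : ℕ} {d : ℕ → Fin s} {i : Fin s} {N : ℕ}
    (h : ∀ k ≥ N, d k ≠ i) : ¬ HasFrequency d i ((s : ℝ)⁻¹) := fun hf => by
  have hs : (s : ℝ) ≠ 0 := by exact_mod_cast (Fin.pos i).ne'
  exact inv_ne_zero hs (tendsto_nhds_unique hf (hasFrequency_zero_of_eventually_ne h))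

lemma eq_of_ofDigits_eq_of_hasFrequency {s : ℕ} (hs : 1 < s) {d e : ℕ → Fin s}
    (hd : ∀ i, HasFrequency d i ((s : ℝ)⁻¹)) (hv : Real.ofDigits d = Real.ofDigits e) :
    d = e := by
  by_contra hne
  obtain ⟨c, N, hc⟩ := exists_eventually_const_of_ofDigits_eq hne hv
  have : Nontrivial (Fin s) := Fin.nontrivial_iff_two_le.mpr hs
  obtain ⟨i, hi⟩ := exists_ne c
  exact not_hasFrequency_inv_of_eventually_ne (N := N) (fun k hk => by rw [hc k hk]; exact hi.symm)
    (hd i)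

/-- Turns digit frequencies into the mean value of the digits. -/
lemma sum_val_mul_digitCount {s : ℕ} (d : ℕ → Fin s) (k : ℕ) :
    ∑ i : Fin s, (i : ℕ) * digitCount d i k = ∑ j ∈ Finset.range k, (d j : ℕ) := by
  rw [← Finset.sum_fiberwise (Finset.range k) d]
  refine Finset.sum_congr rfl fun i _ => ?_
  rw [Finset.sum_congr rfl (g := fun _ => (i : ℕ)) (by simp +contextual), Finset.sum_const,
    smul_eq_mul, mul_comm, digitCount]

/-! ### Concatenations of blocks -/

/-- The total length of the first `n` blocks. -/
def blockEnd {s : ℕ} (α : ℕ → Fin s) (n : ℕ) : ℕ := ∑ i ∈ Finset.range n, (α i : ℕ)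

lemma blockEnd_succ {s : ℕ} (α : ℕ → Fin s) (n : ℕ) :
    blockEnd α (n + 1) = blockEnd α n + α n := Finset.sum_range_succ _ _

lemma blockEnd_strictMono {s : ℕ} {α : ℕ → Fin s} (hα : ∀ n, (α n : ℕ) ≠ 0) :
    StrictMono (blockEnd α) := strictMono_nat_of_lt_succ fun n => by
  rw [blockEnd_succ]
  exact Nat.lt_add_of_pos_right (Nat.pos_of_ne_zero (hα n))

namespace IsBlockConcat

variable {s : ℕ} {u : Fin s} {α d : ℕ → Fin s}

lemma apply_of_succ_eq (h : IsBlockConcat u α d) {n k : ℕ} (hk : k + 1 = blockEnd α (n + 1)) :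
    d k = α n := h.1 n k hk

lemma apply_of_lt (h : IsBlockConcat u α d) (hα : ∀ n, (α n : ℕ) ≠ 0) {n k : ℕ}
    (hk : blockEnd α n ≤ k) (hk' : k + 1 < blockEnd α (n + 1)) : d k = u := by
  refine h.2 k fun m hm => ?_
  change k + 1 = blockEnd α (m + 1) at hm
  have h1 := (blockEnd_strictMono hα).lt_iff_lt.mp (hm ▸ hk')
  have h2 := (blockEnd_strictMono hα).lt_iff_lt.mp (hm ▸ Nat.lt_add_one_of_le hk)
  omega

lemma apply_eq_or (h : IsBlockConcat u α d) (k : ℕ) : d k = u ∨ ∃ n, d k = α n := by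
  by_cases hk : ∃ n, k + 1 = ∑ i ∈ Finset.range (n + 1), (α i : ℕ)
  · obtain ⟨n, hn⟩ := hk
    exact Or.inr ⟨n, h.1 n k hn⟩
  · push Not at hk
    exact Or.inl (h.2 k hk)

lemma sum_range_blockEnd (h : IsBlockConcat u α d) (hα : ∀ n, (α n : ℕ) ≠ 0)
    (hu : (u : ℕ) = 0) (n : ℕ) :
    ∑ k ∈ Finset.range (blockEnd α n), (d k : ℕ) = blockEnd α n := by
  induction n with
  | zero => simp [blockEnd]
  | succ n ih =>
    obtain ⟨a, ha⟩ := Nat.exists_eq_succ_of_ne_zero (hα n)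
    have hs := blockEnd_succ α n
    have hend : d (blockEnd α n + a) = α n := h.apply_of_succ_eq (by omega)
    have hzero : ∑ k ∈ Finset.range a, (d (blockEnd α n + k) : ℕ) = 0 :=
      Finset.sum_eq_zero fun k hk => by
        rw [Finset.mem_range] at hk
        rw [h.apply_of_lt hα (n := n) (by omega) (by omega), hu]
    rw [hs, ha, Nat.succ_eq_add_one, Finset.sum_range_add, Finset.sum_range_succ, ih, hzero, hend,
      ha, zero_add]

/-- The first `n` block labels determine the digits up to the end of the `n`-th block. -/
lemma apply_eq_apply {β e : ℕ → Fin s} (h : IsBlockConcat u α d) (h' : IsBlockConcat u β e)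
    (hα : ∀ n, (α n : ℕ) ≠ 0) (hβ : ∀ n, (β n : ℕ) ≠ 0) {n : ℕ} (hαβ : ∀ i < n, α i = β i) :
    ∀ k < blockEnd α n, d k = e k := by
  induction n with
  | zero => simp [blockEnd]
  | succ n ih =>
    intro k hk
    have hend : ∀ m ≤ n + 1, blockEnd α m = blockEnd β m := fun m hm =>
      Finset.sum_congr rfl fun i hi => by
        rw [hαβ i ((Finset.mem_range.mp hi).trans_le hm)]
    rcases lt_or_ge k (blockEnd α n) with hlt | hge
    · exact ih (fun i hi => hαβ i (by omega)) k hlt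
    · rcases (Nat.succ_le_of_lt hk).lt_or_eq with hk' | hk'
      · rw [h.apply_of_lt hα hge hk',
          h'.apply_of_lt hβ (hend n (by omega) ▸ hge) (hend (n + 1) le_rfl ▸ hk')]
      · rw [h.apply_of_succ_eq hk', h'.apply_of_succ_eq ((hend (n + 1) le_rfl) ▸ hk'),
          hαβ n (by omega)]

/-- Only in base `3` can all digits of a concatenation of blocks `0 … 0 αₙ` be equally
frequent: the digits up to the end of a block have mean value `1`. -/
lemma eq_three_of_hasFrequency (h : IsBlockConcat u α d) (hα : ∀ n, (α n : ℕ) ≠ 0)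
    (hu : (u : ℕ) = 0) (hd : ∀ i, HasFrequency d i ((s : ℝ)⁻¹)) : s = 3 := by
  have hs0 : (s : ℝ) ≠ 0 := by exact_mod_cast (Fin.pos u).ne'
  have hlim : Tendsto (fun n => ∑ i : Fin s, ((i : ℕ) : ℝ) *
      ((digitCount d i (blockEnd α n) : ℝ) / (blockEnd α n : ℝ))) atTop
      (𝓝 (∑ i : Fin s, ((i : ℕ) : ℝ) * (s : ℝ)⁻¹)) :=
    tendsto_finsetSum _ fun i _ =>
      ((hd i).comp (blockEnd_strictMono hα).tendsto_atTop).const_mul _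
  have hone : ∀ᶠ n in atTop, ∑ i : Fin s, ((i : ℕ) : ℝ) *
      ((digitCount d i (blockEnd α n) : ℝ) / (blockEnd α n : ℝ)) = 1 := by
    filter_upwards [eventually_gt_atTop 0] with n hn
    have hpos : 0 < blockEnd α n := by
      simpa [blockEnd] using blockEnd_strictMono hα hn
    have hsum := sum_val_mul_digitCount d (blockEnd α n)
    rw [h.sum_range_blockEnd hα hu] at hsum
    have hsum' : ∑ i : Fin s, ((i : ℕ) : ℝ) * (digitCount d i (blockEnd α n) : ℝ) =
        blockEnd α n := by exact_mod_cast hsum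
    simp_rw [← mul_div_assoc]
    rw [← Finset.sum_div, hsum', div_self (by exact_mod_cast hpos.ne')]
  have heq := tendsto_nhds_unique (hlim.congr' hone) tendsto_const_nhds
  rw [← Finset.sum_mul, mul_inv_eq_one₀ hs0] at heq
  have hnat : ∑ i ∈ Finset.range s, i = s := by
    rw [← Fin.sum_univ_eq_sum_range (fun i => i)]
    exact_mod_cast heq
  -- The limit of the means gives `0 + … + (s - 1) = s`, that is, `s * 2 = s * (s - 1)`.
  have hg := Finset.sum_range_id_mul_two s
  rw [hnat] at hg
  have := Nat.eq_of_mul_eq_mul_left (Fin.pos u) hg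
  omega

end IsBlockConcat

lemma exists_isBlockConcat_of_mem {s : ℕ} (hs : 1 < s) {x : ℝ}
    (hx : x ∈ normalNumbers s ∩ S₀ s) :
    ∃ (u : Fin s) (α d : ℕ → Fin s), (u : ℕ) = 0 ∧ x ∈ S s u ∧ (∀ n, (α n : ℕ) ≠ 0) ∧
      IsBlockConcat u α d ∧ ∀ i, HasFrequency d i ((s : ℝ)⁻¹) := by
  obtain ⟨⟨-, e, hxe, hfreq⟩, hx0⟩ := hx
  obtain ⟨u, hu⟩ := Set.mem_iUnion.mp hx0
  obtain ⟨α, d, hα, hblock, hxd⟩ := id hu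
  obtain rfl := eq_of_ofDigits_eq_of_hasFrequency hs hfreq (hxe.symm.trans hxd)
  refine ⟨u, α, e, ?_, hu, fun n => (hα n).1, hblock, hfreq⟩
  -- If `u ≠ 0`, every digit is `u` or a label, so 0 never occurs.
  by_contra hu0
  refine not_hasFrequency_inv_of_eventually_ne (i := ⟨0, by omega⟩) (N := 0) (fun k _ hk => ?_)
    (hfreq ⟨0, by omega⟩)
  have hk0 : (e k : ℕ) = 0 := by rw [hk]
  rcases hblock.apply_eq_or k with h | ⟨n, h⟩
  · exact hu0 (h ▸ hk0)
  · exact (hα n).1 (h ▸ hk0)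

lemma normalNumbers_inter_S₀_eq_empty {s : ℕ} (hs : 2 < s) (hs3 : s ≠ 3) :
    normalNumbers s ∩ S₀ s = ∅ := by
  refine Set.eq_empty_of_forall_notMem fun x hx => ?_
  obtain ⟨u, α, d, hu, -, hα, hblock, hfreq⟩ := exists_isBlockConcat_of_mem (by omega) hx
  exact hs3 (hblock.eq_three_of_hasFrequency hα hu hfreq)

lemma normalNumbers_inter_S₀_subset : normalNumbers 3 ∩ S₀ 3 ⊆ S 3 0 := by
  intro x hx
  obtain ⟨u, -, -, hu, hxu, -⟩ := exists_isBlockConcat_of_mem (by norm_num) hx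
  have : u = 0 := Fin.ext hu
  exact this ▸ hxu

/-! ### The upper bound for the dimension -/

/-- The elements of `S 3 0` whose first `n` block labels are `w i + 1`. -/
def cylinder (n : ℕ) (w : Fin n → Fin 2) : Set ℝ :=
  {x | ∃ α d : ℕ → Fin 3, (∀ k, (α k : ℕ) ≠ 0) ∧ IsBlockConcat 0 α d ∧ x = Real.ofDigits d ∧
    ∀ i : Fin n, (α i : ℕ) = (w i : ℕ) + 1}

lemma S_three_zero_subset_iUnion_cylinder (n : ℕ) : S 3 0 ⊆ ⋃ w, cylinder n w := by
  rintro x ⟨α, d, hα, hblock, hx⟩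
  refine Set.mem_iUnion.mpr ⟨fun i => ⟨(α i : ℕ) - 1, ?_⟩, α, d, fun k => (hα k).1, hblock, hx,
    fun i => ?_⟩
  · have := (α i).isLt
    omega
  · have := (hα i).1
    dsimp only
    omega

/-- The `n` labels fix as many digits as their sum, one factor `1/3` per digit. -/
lemma ediam_cylinder_le (n : ℕ) (w : Fin n → Fin 2) :
    Metric.ediam (cylinder n w) ≤ ENNReal.ofReal (∏ i, (3⁻¹ : ℝ) ^ ((w i : ℕ) + 1)) := by
  refine Metric.ediam_le ?_
  rintro x ⟨α, d, hα, hblock, rfl, hαw⟩ y ⟨β, e, hβ, hblock', rfl, hβw⟩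
  rw [edist_dist, Real.dist_eq]
  refine ENNReal.ofReal_le_ofReal ?_
  have hend : blockEnd α n = ∑ i : Fin n, ((w i : ℕ) + 1) := by
    rw [blockEnd, ← Fin.sum_univ_eq_sum_range (fun i => (α i : ℕ))]
    exact Finset.sum_congr rfl fun i _ => hαw i
  have hαβ : ∀ i < n, α i = β i := fun i hi =>
    Fin.ext ((hαw ⟨i, hi⟩).trans (hβw ⟨i, hi⟩).symm)
  refine (Real.abs_ofDigits_sub_ofDigits_le
    (hblock.apply_eq_apply hblock' hα hβ hαβ)).trans_eq ?_
  rw [Finset.prod_pow_eq_pow_sum, ← hend, inv_pow]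
  norm_num

lemma dimH_S_three_zero_le :
    dimH (S 3 0) ≤ ENNReal.ofReal (Real.logb 3 (2 / (Real.sqrt 5 - 1))) := by
  have h5 : Real.sqrt 5 ^ 2 = 5 := Real.sq_sqrt (by norm_num)
  have h5' : 1 < Real.sqrt 5 := Real.lt_sqrt_of_sq_lt (by norm_num)
  have h5'' : Real.sqrt 5 < 3 := (Real.sqrt_lt' (by norm_num)).mpr (by norm_num)
  set t := Real.logb 3 (2 / (Real.sqrt 5 - 1)) with ht
  have ht0 : 0 ≤ t := Real.logb_nonneg (by norm_num) (by
    rw [le_div_iff₀ (by linarith)]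
    linarith)
  set q : ℝ := (Real.sqrt 5 - 1) / 2 with hq
  have hq0 : 0 < q := by rw [hq]; linarith
  have hqt : (3⁻¹ : ℝ) ^ t = q := by
    rw [Real.inv_rpow (by norm_num), ht, Real.rpow_logb (by norm_num) (by norm_num)
      (div_pos two_pos (by linarith)), inv_div]
  -- `q` is the positive root of `q + q² = 1`; this makes the `t`-th powers of the diameter bounds
  -- sum to 1 at every level.
  have hq1 : ∑ j : Fin 2, q ^ ((j : ℕ) + 1) = 1 := by
    rw [Fin.sum_univ_two]
    simp only [Fin.val_zero, Fin.val_one, hq]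
    nlinarith
  have hterm : ∀ n (w : Fin n → Fin 2), Metric.ediam (cylinder n w) ^ t ≤
      ENNReal.ofReal (∏ i, q ^ ((w i : ℕ) + 1)) := by
    intro n w
    refine (ENNReal.rpow_le_rpow (ediam_cylinder_le n w) ht0).trans_eq ?_
    rw [ENNReal.ofReal_rpow_of_nonneg (by positivity) ht0,
      ← Real.finsetProd_rpow _ _ (fun i _ => by positivity)]
    congr 1
    refine Finset.prod_congr rfl fun i _ => ?_
    rw [← hqt, ← Real.rpow_natCast, ← Real.rpow_natCast, ← Real.rpow_mul (by norm_num),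
      ← Real.rpow_mul (by norm_num), mul_comm]
  have hsum : ∀ n, ∑ w, Metric.ediam (cylinder n w) ^ t ≤ 1 := by
    intro n
    refine (Finset.sum_le_sum fun w _ => hterm n w).trans_eq ?_
    rw [← ENNReal.ofReal_sum_of_nonneg (fun w _ => by positivity),
      -- The sum over label words factors as `(q + q²)ⁿ`.
      ← Fintype.sum_pow (fun j : Fin 2 => q ^ ((j : ℕ) + 1)) n, hq1, one_pow, ENNReal.ofReal_one]
  have hdiam : ∀ n (w : Fin n → Fin 2), Metric.ediam (cylinder n w) ≤
      ENNReal.ofReal ((3⁻¹ : ℝ) ^ n) := by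
    intro n w
    refine (ediam_cylinder_le n w).trans (ENNReal.ofReal_le_ofReal ?_)
    rw [Finset.prod_pow_eq_pow_sum]
    refine pow_le_pow_of_le_one (by norm_num) (by norm_num) ?_
    simpa using Finset.card_nsmul_le_sum Finset.univ (fun i => (w i : ℕ) + 1) 1 (by simp)
  have hzero : Tendsto (fun n : ℕ => ENNReal.ofReal ((3⁻¹ : ℝ) ^ n)) atTop (𝓝 0) := by
    rw [← ENNReal.ofReal_zero]
    exact ENNReal.tendsto_ofReal
      (tendsto_pow_atTop_nhds_zero_of_lt_one (by norm_num) (by norm_num))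
  refine dimH_le_of_hausdorffMeasure_ne_top (d := t.toNNReal) ?_
  rw [Real.coe_toNNReal t ht0]
  have hle := MeasureTheory.Measure.hausdorffMeasure_le_liminf_sum t (S 3 0) _ hzero cylinder
    (.of_forall hdiam) (.of_forall S_three_zero_subset_iUnion_cylinder)
  refine (hle.trans ?_).trans_lt ENNReal.one_lt_top |>.ne
  exact (liminf_le_liminf (.of_forall hsum)).trans_eq (liminf_const 1)

/-! ### The lower bound for the dimension -/

/-- The digit sequence made of the words `021` (for `b n = 0`) and `102` (for `b n = 1`). -/
def wordDigits (b : ℕ → Fin 2) (k : ℕ) : Fin 3 :=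
  (![![0, 2, 1], ![1, 0, 2]] : Fin 2 → Fin 3 → Fin 3) (b (k / 3)) (Fin.ofNat 3 k)

/-- The block labels of `wordDigits b`. -/
def wordLabels (b : ℕ → Fin 2) (m : ℕ) : Fin 3 :=
  (![![2, 1], ![1, 2]] : Fin 2 → Fin 2 → Fin 3) (b (m / 2)) (Fin.ofNat 2 m)

lemma wordDigits_apply (b : ℕ → Fin 2) (n : ℕ) (j : Fin 3) :
    wordDigits b (3 * n + j) =
      (![![0, 2, 1], ![1, 0, 2]] : Fin 2 → Fin 3 → Fin 3) (b n) j := by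
  have h1 : (3 * n + (j : ℕ)) / 3 = n := by omega
  have h2 : Fin.ofNat 3 (3 * n + (j : ℕ)) = j := by ext; simp [Fin.ofNat]
  rw [wordDigits, h1, h2]

lemma wordLabels_apply (b : ℕ → Fin 2) (n : ℕ) (j : Fin 2) :
    wordLabels b (2 * n + j) = (![![2, 1], ![1, 2]] : Fin 2 → Fin 2 → Fin 3) (b n) j := by
  have h1 : (2 * n + (j : ℕ)) / 2 = n := by omega
  have h2 : Fin.ofNat 2 (2 * n + (j : ℕ)) = j := by ext; simp [Fin.ofNat]; omega
  rw [wordLabels, h1, h2]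

lemma wordLabels_ne_zero (b : ℕ → Fin 2) (m : ℕ) : wordLabels b m ≠ 0 := by
  unfold wordLabels
  generalize b (m / 2) = c, Fin.ofNat 2 m = j
  revert c j
  decide

/-- Each word consists of two blocks, of lengths 2, 1 or 1, 2. -/
lemma blockEnd_wordLabels_even (b : ℕ → Fin 2) (n : ℕ) :
    blockEnd (wordLabels b) (2 * n) = 3 * n := by
  induction n with
  | zero => simp [blockEnd]
  | succ n ih =>
    have h0 := wordLabels_apply b n 0
    have h1 := wordLabels_apply b n 1
    simp only [Fin.val_zero, Fin.val_one, add_zero] at h0 h1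
    rw [show 2 * (n + 1) = 2 * n + 1 + 1 by ring, blockEnd_succ, blockEnd_succ, ih, h0, h1]
    generalize b n = c
    fin_cases c <;> simp <;> ring

lemma blockEnd_wordLabels_odd (b : ℕ → Fin 2) (n : ℕ) :
    blockEnd (wordLabels b) (2 * n + 1) = 3 * n + (![2, 1] : Fin 2 → ℕ) (b n) := by
  have h0 := wordLabels_apply b n 0
  simp only [Fin.val_zero, add_zero] at h0
  rw [blockEnd_succ, blockEnd_wordLabels_even, h0]
  generalize b n = c
  fin_cases c <;> simp

lemma isBlockConcat_wordDigits (b : ℕ → Fin 2) :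
    IsBlockConcat 0 (wordLabels b) (wordDigits b) := by
  constructor
  · intro n k hk
    change k + 1 = blockEnd _ (n + 1) at hk
    obtain ⟨m, rfl | rfl⟩ := n.even_or_odd'
    · rw [blockEnd_wordLabels_odd] at hk
      have h0 := wordLabels_apply b m 0
      have d0 := wordDigits_apply b m 0
      have d1 := wordDigits_apply b m 1
      simp only [Fin.val_zero, Fin.val_one, add_zero] at h0 d0 d1
      rw [h0]
      generalize b m = c at *
      fin_cases c
      · obtain rfl : k = 3 * m + 1 := by simpa using hk
        simpa using d1
      · obtain rfl : k = 3 * m := by simpa using hk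
        simpa using d0
    · rw [show 2 * m + 1 + 1 = 2 * (m + 1) by ring, blockEnd_wordLabels_even] at hk
      obtain rfl : k = 3 * m + 2 := by omega
      have h1 := wordLabels_apply b m 1
      have d2 := wordDigits_apply b m 2
      simp only [Fin.val_one, Fin.val_two] at h1 d2
      rw [h1, d2]
      generalize b m = c
      fin_cases c <;> rfl
  · intro k hk
    change ∀ n, k + 1 ≠ blockEnd _ (n + 1) at hk
    -- Excluding the two block ends inside the word containing place `k` leaves only the place of
    -- its digit 0.
    have h1 := hk (2 * (k / 3))
    have h2 := hk (2 * (k / 3) + 1)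
    rw [blockEnd_wordLabels_odd] at h1
    rw [show 2 * (k / 3) + 1 + 1 = 2 * (k / 3 + 1) by ring, blockEnd_wordLabels_even] at h2
    have d := wordDigits_apply b (k / 3) ⟨k % 3, Nat.mod_lt _ (by norm_num)⟩
    simp only [Nat.div_add_mod] at d
    rw [d]
    have hk3 := Nat.div_add_mod k 3
    generalize b (k / 3) = c at *
    have : k % 3 = 0 ∨ k % 3 = 1 := by omega
    fin_cases c <;> simp at h1 <;> rcases this with h | h <;> simp [h] <;> omega

lemma digitCount_wordDigits (b : ℕ → Fin 2) (i : Fin 3) (n : ℕ) :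
    digitCount (wordDigits b) i (3 * n) = n := by
  induction n with
  | zero => simp [digitCount]
  | succ n ih =>
    have d0 := wordDigits_apply b n 0
    have d1 := wordDigits_apply b n 1
    have d2 := wordDigits_apply b n 2
    simp only [Fin.val_zero, Fin.val_one, Fin.val_two, add_zero] at d0 d1 d2
    simp only [digitCount, Finset.card_filter] at ih ⊢
    rw [show 3 * (n + 1) = 3 * n + 1 + 1 + 1 by ring, Finset.sum_range_succ,
      Finset.sum_range_succ, Finset.sum_range_succ, ih, d0, show 3 * n + 1 + 1 = 3 * n + 2 by ring,
      d1, d2]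
    generalize b n = c
    fin_cases c <;> fin_cases i <;> simp

lemma digitCount_mono {s : ℕ} (d : ℕ → Fin s) (i : Fin s) : Monotone (digitCount d i) :=
  fun _ _ h => Finset.card_le_card
    (Finset.filter_subset_filter _ (Finset.range_subset_range.mpr h))

lemma hasFrequency_wordDigits (b : ℕ → Fin 2) (i : Fin 3) :
    HasFrequency (wordDigits b) i (((3 : ℕ) : ℝ)⁻¹) := by
  rw [HasFrequency, tendsto_iff_dist_tendsto_zero]
  refine squeeze_zero' (.of_forall fun k => dist_nonneg) ?_
    (tendsto_const_div_atTop_nhds_zero_nat (1 : ℝ))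
  filter_upwards [eventually_gt_atTop 0] with k hk
  -- Counts are exact at multiples of 3; monotonicity keeps the count at `k` within 1 of `k / 3`.
  have h1 := digitCount_mono (wordDigits b) i (Nat.mul_div_le k 3)
  have h2 := digitCount_mono (wordDigits b) i (show k ≤ 3 * (k / 3 + 1) by omega)
  rw [digitCount_wordDigits] at h1 h2
  set c := digitCount (wordDigits b) i k
  have h3 : (k : ℝ) ≤ 3 * c + 2 := by
    have : k ≤ 3 * c + 2 := by omega
    exact_mod_cast this
  have h4 : 3 * (c : ℝ) ≤ k + 3 := by
    have : 3 * c ≤ k + 3 := by omega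
    exact_mod_cast this
  have hk' : (0 : ℝ) < k := by exact_mod_cast hk
  have heq : (c : ℝ) / k - ((3 : ℕ) : ℝ)⁻¹ = (c - k / 3) / k := by
    push_cast
    field_simp
  rw [Real.dist_eq, heq, abs_div, abs_of_pos hk']
  gcongr
  rw [abs_le]
  constructor <;> linarith

lemma ofDigits_wordDigits_mem (b : ℕ → Fin 2) :
    Real.ofDigits (wordDigits b) ∈ normalNumbers 3 ∩ S₀ 3 :=
  ⟨⟨⟨Real.ofDigits_nonneg _, Real.ofDigits_le_one _⟩, _, rfl, hasFrequency_wordDigits b⟩,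
    Set.mem_iUnion.mpr ⟨0, wordLabels b, wordDigits b,
      fun n => ⟨fun h => wordLabels_ne_zero b n (Fin.ext h), wordLabels_ne_zero b n⟩,
      isBlockConcat_wordDigits b, rfl⟩⟩

lemma wordDigits_add (b : ℕ → Fin 2) (n : ℕ) :
    (fun k => wordDigits b (k + 3 * n)) = wordDigits fun i => b (i + n) := by
  funext k
  have h1 : (k + 3 * n) / 3 = k / 3 + n := by omega
  have h2 : Fin.ofNat 3 (k + 3 * n) = Fin.ofNat 3 k := by ext; simp [Fin.ofNat]
  rw [wordDigits, wordDigits, h1, h2]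

/-- The left number is at most `(7 + 1) / 27`, the right one at least `11 / 27`. The weaker gap `1 /
27` fits the scale of one word. -/
lemma ofDigits_wordDigits_gap {b c : ℕ → Fin 2} (hb : b 0 = 0) (hc : c 0 = 1) :
    Real.ofDigits (wordDigits b) + 27⁻¹ ≤ Real.ofDigits (wordDigits c) := by
  have hb' := Real.ofDigits_eq_sum_add_ofDigits (wordDigits b) 3
  have hc' := Real.ofDigits_eq_sum_add_ofDigits (wordDigits c) 3
  have h1 := Real.ofDigits_le_one fun i => wordDigits b (i + 3)
  have h2 := Real.ofDigits_nonneg fun i => wordDigits c (i + 3)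
  simp [Finset.sum_range_succ, Real.ofDigitsTerm, wordDigits, Fin.ofNat, hb, hc] at hb' hc' h1 h2
  rw [hb', hc']
  norm_num
  linarith

lemma exists_pow_le_abs_ofDigits_wordDigits_sub {b c : ℕ → Fin 2} (h : b ≠ c) :
    ∃ n, (∀ i < n, b i = c i) ∧
      (27⁻¹ : ℝ) ^ (n + 1) ≤
        |Real.ofDigits (wordDigits b) - Real.ofDigits (wordDigits c)| := by
  obtain ⟨n, hn, hlt⟩ := exists_first_difference h
  refine ⟨n, hlt, ?_⟩
  have hagree : ∀ k < 3 * n, wordDigits b k = wordDigits c k := fun k hk => by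
    rw [wordDigits, wordDigits, hlt (k / 3) (by omega)]
  rw [ofDigits_sub_ofDigits hagree, wordDigits_add, wordDigits_add, abs_mul,
    abs_of_pos (by positivity), pow_mul, ← inv_pow, pow_succ]
  norm_num only [Nat.cast_ofNat]
  gcongr
  have hcases : (b n = 0 ∧ c n = 1) ∨ (b n = 1 ∧ c n = 0) := by omega
  rcases hcases with ⟨h0, h1⟩ | ⟨h1, h0⟩
  · have := ofDigits_wordDigits_gap (b := fun i => b (i + n)) (c := fun i => c (i + n))
      (by simpa using h0) (by simpa using h1)
    rw [abs_sub_comm]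
    exact (by linarith : _ ≤ _).trans (le_abs_self _)
  · have := ofDigits_wordDigits_gap (b := fun i => c (i + n)) (c := fun i => b (i + n))
      (by simpa using h0) (by simpa using h1)
    exact (by linarith : _ ≤ _).trans (le_abs_self _)

lemma ofDigits_wordDigits_injective :
    Function.Injective fun b : ℕ → Fin 2 => Real.ofDigits (wordDigits b) := by
  intro b c hbc
  by_contra hne
  obtain ⟨n, -, hn⟩ := exists_pow_le_abs_ofDigits_wordDigits_sub hne
  rw [sub_eq_zero.mpr hbc, abs_zero] at hn
  exact absurd hn (not_le.mpr (by positivity))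

lemma mk_normalNumbers_inter_S₀ :
    Cardinal.mk ↥(normalNumbers 3 ∩ S₀ 3) = Cardinal.continuum := by
  refine le_antisymm ((Cardinal.mk_set_le _).trans_eq Cardinal.mk_real) ?_
  have hinj : Function.Injective fun b : ℕ → Fin 2 =>
      (⟨_, ofDigits_wordDigits_mem b⟩ : ↥(normalNumbers 3 ∩ S₀ 3)) :=
    fun b c h => ofDigits_wordDigits_injective (congrArg Subtype.val h)
  have hle := Cardinal.mk_le_of_injective hinj
  rwa [← Cardinal.power_def, Cardinal.mk_fin, Cardinal.mk_nat, Nat.cast_ofNat,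
    Cardinal.two_power_aleph0] at hle

lemma le_dimH_normalNumbers_inter_S₀ :
    ENNReal.ofReal (1 / 3 * Real.logb 3 2) ≤ dimH (normalNumbers 3 ∩ S₀ 3) := by
  set g : (ℕ → Fin 2) → ℝ := fun b => Real.ofDigits (wordDigits b) with hg
  set r : ℝ := 1 / 3 * Real.logb 3 2 with hr
  have hr0 : 0 < r := mul_pos (by norm_num) (Real.logb_pos (by norm_num) (by norm_num))
  have h27 : (27⁻¹ : ℝ) ^ r = 2⁻¹ := by
    rw [Real.inv_rpow (by norm_num), show (27 : ℝ) = 3 ^ (3 : ℝ) by norm_num,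
      ← Real.rpow_mul (by norm_num), hr, ← mul_assoc, mul_one_div_cancel (by norm_num), one_mul,
      Real.rpow_logb (by norm_num) (by norm_num) (by norm_num)]
  -- `f` recovers the choices of words and reads them in base 2; its values off the range of `g`
  -- play no role.
  set f : ℝ → ℝ := fun x => Real.ofDigits (Function.invFun g x) with hf
  have hfg : ∀ b, f (g b) = Real.ofDigits b := fun b => by
    rw [hf]
    exact congrArg _ (Function.leftInverse_invFun ofDigits_wordDigits_injective b)
  have hholder : HolderOnWith 2 r.toNNReal f (Set.range g) := by
    rintro _ ⟨b, rfl⟩ _ ⟨c, rfl⟩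
    rcases eq_or_ne b c with rfl | hne
    · simp
    obtain ⟨n, hagree, hn⟩ := exists_pow_le_abs_ofDigits_wordDigits_sub hne
    rw [hfg, hfg, edist_dist, edist_dist, Real.dist_eq, Real.dist_eq, Real.coe_toNNReal r hr0.le,
      ENNReal.ofReal_rpow_of_nonneg (abs_nonneg _) hr0.le, ENNReal.coe_ofNat,
      ← ENNReal.ofReal_ofNat, ← ENNReal.ofReal_mul (by norm_num)]
    refine ENNReal.ofReal_le_ofReal ?_
    calc |Real.ofDigits b - Real.ofDigits c| ≤ (((2 : ℕ) : ℝ) ^ n)⁻¹ :=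
          Real.abs_ofDigits_sub_ofDigits_le hagree
      -- Since `27⁻ʳ = 1/2`, the Hölder constant 2 absorbs the shift from `n` to `n + 1`.
      _ = 2 * ((27⁻¹ : ℝ) ^ (n + 1)) ^ r := by
          rw [← Real.rpow_natCast (27⁻¹), ← Real.rpow_mul (by norm_num), mul_comm _ r,
            Real.rpow_mul (by norm_num), h27, Real.rpow_natCast, pow_succ, Nat.cast_ofNat, inv_pow]
          ring
      _ ≤ 2 * |g b - g c| ^ r := by
          gcongr
  have hsub : Set.range g ⊆ normalNumbers 3 ∩ S₀ 3 := by
    rintro _ ⟨b, rfl⟩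
    exact ofDigits_wordDigits_mem b
  refine le_trans ?_ (dimH_mono hsub)
  have himage : Set.Icc (0 : ℝ) 1 ⊆ f '' Set.range g := by
    intro y hy
    obtain ⟨b, -, hb⟩ := Real.ofDigits_SurjOn (b := 2) one_lt_two hy
    exact ⟨g b, ⟨b, rfl⟩, (hfg b).trans hb⟩
  have hIcc : dimH (Set.Icc (0 : ℝ) 1) = 1 := by
    rw [Real.dimH_of_nonempty_interior (by simp), Module.finrank_self, Nat.cast_one]
  have hle := (hIcc.symm.trans_le (dimH_mono himage)).trans
    (hholder.dimH_image_le (Real.toNNReal_pos.mpr hr0))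
  rw [ENNReal.le_div_iff_mul_le (Or.inl (by simpa using hr0)) (Or.inl ENNReal.coe_ne_top),
    one_mul] at hle
  exact hle

end SAdic

theorem theorem7 (s : ℕ) (hs : 2 < s) :
    (s = 3 →
      Cardinal.mk ↥(SAdic.normalNumbers 3 ∩ SAdic.S₀ 3) = Cardinal.continuum ∧
      SAdic.normalNumbers 3 ∩ SAdic.S₀ 3 ⊆ SAdic.S 3 0 ∧
      ENNReal.ofReal (1 / 3 * Real.logb 3 2) ≤ dimH (SAdic.normalNumbers 3 ∩ SAdic.S₀ 3) ∧
      dimH (SAdic.normalNumbers 3 ∩ SAdic.S₀ 3) ≤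
        ENNReal.ofReal (Real.logb 3 (2 / (Real.sqrt 5 - 1)))) ∧
    (s ≠ 3 → SAdic.normalNumbers s ∩ SAdic.S₀ s = ∅) :=
  ⟨fun _ => ⟨SAdic.mk_normalNumbers_inter_S₀, SAdic.normalNumbers_inter_S₀_subset,
    SAdic.le_dimH_normalNumbers_inter_S₀,
    (dimH_mono SAdic.normalNumbers_inter_S₀_subset).trans SAdic.dimH_S_three_zero_le⟩,
    SAdic.normalNumbers_inter_S₀_eq_empty hs⟩
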